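/- \textbf{Theorem (Cardinality Theorem for right return words).} Let $A$ be a finite alphabet, let $\theta : A \to A$ be an involution (possibly with fixed points), and let $S$ be a recurrent specular set on $A$ relative to $\theta$. Then for every nonempty word $x \in S$, the set $\mathcal{R}_S(x)$ of right return words to $x$ in $S$ is finite and has exactly $\operatorname{Card}(A) - 1$ elements. Here the terms have the following meaning; $\varepsilon$ denotes the empty word. A set $S$ of words on $A$ is \emph{factorial} if it contains all letters of $A$ and all factors of its elements; it is \emph{biextendable} if it is factorial and for every $w \in S$ there are letters $a, b \in A$ with $awb \in S$; it is \emph{recurrent} if $S \neq \{\varepsilon\}$, $S$ is factorial, and for all $u, w \in S$ there is $v \in S$ with $uvw \in S$. For $w \in S$, the \emph{extension graph} $\mathcal{E}_S(w)$ is the undirected graph whose vertex set is the disjoint union of $\{a \in A : aw \in S\}$ and $\{b \in A : wb \in S\}$, with an edge between $a$ in the first set and $b$ in the second one exactly when $awb \in S$. The set $S$ is a \emph{specular set} on $A$ relative to $\theta$ if \begin{itemize} \item $S$ is biextendable; \item every $w \in S$ is reduced, i.e. has no factor $a\,\theta(a)$ with $a \in A$; \item $S$ is closed under inverses (in the group generated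 by $A$ with the relations $a\,\theta(a) = 1$): if $a_1 a_2 \cdots a_n \in S$, then $\theta(a_n) \cdots \theta(a_2)\theta(a_1) \in S$; \item $\mathcal{E}_S(w)$ is a tree for every nonempty $w \in S$, and $\mathcal{E}_S(\varepsilon)$ is a union of two disjoint trees (that is, it is acyclic with exactly two connected components). \end{itemize} For a nonempty word $x \in S$, a \emph{complete return word} to $x$ is a word $y \in S$ that has $x$ as a proper prefix and as a proper suffix, but does not have $x$ as an internal factor, i.e. $y \neq uxu'$ for all nonempty words $u, u'$. A \emph{right return word} to $x$ in $S$ is a word $w$ such that $xw$ is a complete return word to $x$. -/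

import Mathlib

namespace Specular

variable {A : Type*}

/-- A set of words is factorial if it contains every letter of the alphabet (as a word of
length one) and every factor of each of its elements. -/
def IsFactorial (S : Set (List A)) : Prop :=
  (∀ a : A, [a] ∈ S) ∧ ∀ w ∈ S, ∀ v : List A, v <:+: w → v ∈ S

/-- The letters `a` such that `aw ∈ S`. -/
def leftExt (S : Set (List A)) (w : List A) : Set A := {a | a :: w ∈ S}

/-- The letters `b` such that `wb ∈ S`. -/
def rightExt (S : Set (List A)) (w : List A) : Set A := {b | w ++ [b] ∈ S}

/-- The pairs of letters `(a, b)` such that `awb ∈ S`. -/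
def biExt (S : Set (List A)) (w : List A) : Set (A × A) := {p | p.1 :: (w ++ [p.2]) ∈ S}

/-- A factorial set all of whose words can be extended simultaneously on both sides. -/
def IsBiextendable (S : Set (List A)) : Prop :=
  IsFactorial S ∧ ∀ w ∈ S, (biExt S w).Nonempty

/-- A set of words `S ≠ {ε}` is recurrent if it is factorial and for all `u, w ∈ S` there is
`v ∈ S` with `uvw ∈ S`. -/
def IsRecurrent (S : Set (List A)) : Prop :=
  S ≠ {[]} ∧ IsFactorial S ∧ ∀ u ∈ S, ∀ w ∈ S, ∃ v ∈ S, u ++ v ++ w ∈ S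

/-- The extension graph of `w`: the undirected graph whose vertices are the disjoint union of
the left extensions and the right extensions of `w`, with an edge between the left
extension `a` and the right extension `b` when `awb ∈ S`. -/
def extensionGraph (S : Set (List A)) (w : List A) :
    SimpleGraph (leftExt S w ⊕ rightExt S w) where
  Adj
    | .inl a, .inr b => ((a : A), (b : A)) ∈ biExt S w
    | .inr b, .inl a => ((a : A), (b : A)) ∈ biExt S w
    | _, _ => False
  symm := ⟨by rintro (a | b) (a' | b') h <;> exact h⟩
  loopless := ⟨by rintro (a | b) h <;> exact h⟩

/-- A graph is a union of `c` (disjoint) trees if it has no cycle and exactly `c` connected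
components. -/
def IsUnionOfTrees {V : Type*} (G : SimpleGraph V) (c : ℕ) : Prop :=
  G.IsAcyclic ∧ ENat.card G.ConnectedComponent = c

/-- Tree sets of characteristic `c`. -/
def IsTreeSet (S : Set (List A)) (c : ℕ) : Prop :=
  IsBiextendable S ∧ (∀ w ∈ S, w ≠ [] → (extensionGraph S w).IsTree) ∧
    IsUnionOfTrees (extensionGraph S []) c

/-- The specular group of an involution `θ` of the alphabet: generators the letters `a`,
relations `a θ(a) = 1`. -/
abbrev SpecularGroup (θ : A → A) : Type _ :=
  PresentedGroup (Set.range fun a : A => FreeGroup.of a * FreeGroup.of (θ a))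

/-- The element of the specular group that a word represents. -/
def wordVal (θ : A → A) (w : List A) : SpecularGroup θ :=
  (w.map fun a => (PresentedGroup.of a : SpecularGroup θ)).prod

/-- The inverse of the word `a₁ ⋯ aₙ`, as the word `θ(aₙ) ⋯ θ(a₁)`. -/
def wordInv (θ : A → A) (w : List A) : List A := (w.map θ).reverse

/-- The word `wordInv θ w` represents the inverse, in the specular group, of the element
represented by `w`. -/
theorem wordVal_wordInv (θ : A → A) (w : List A) :
    wordVal θ (wordInv θ w) = (wordVal θ w)⁻¹ := by
  have key : ∀ a : A, (PresentedGroup.of (θ a) : SpecularGroup θ)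
      = (PresentedGroup.of a : SpecularGroup θ)⁻¹ := by
    intro a
    have h : (PresentedGroup.of a : SpecularGroup θ) * PresentedGroup.of (θ a) = 1 := by
      have := PresentedGroup.one_of_mem
        (rels := Set.range fun a : A => FreeGroup.of a * FreeGroup.of (θ a))
        (Set.mem_range_self a)
      simpa [PresentedGroup.of] using this
    exact eq_inv_of_mul_eq_one_right h
  induction w with
  | nil => simp [wordVal, wordInv]
  | cons a w ih =>
    have h1 : wordInv θ (a :: w) = wordInv θ w ++ [θ a] := by simp [wordInv]
    have h2 : ∀ u v : List A, wordVal θ (u ++ v) = wordVal θ u * wordVal θ v := by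
      intro u v; simp [wordVal]
    have h3 : ∀ b : A, wordVal θ [b] = PresentedGroup.of b := by intro b; simp [wordVal]
    rw [h1, h2, ih, h3, key, ← List.singleton_append, h2, h3, mul_inv_rev]

/-- A word is reduced if it has no factor of the form `a θ(a)`. -/
def IsReduced (θ : A → A) (w : List A) : Prop := ∀ a : A, ¬ [a, θ a] <:+: w

/-- Laminary sets relative to `θ`: biextendable sets of reduced words that are closed under
taking inverses. -/
def IsLaminary (θ : A → A) (S : Set (List A)) : Prop :=
  IsBiextendable S ∧ (∀ w ∈ S, IsReduced θ w) ∧ ∀ w ∈ S, wordInv θ w ∈ S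

/-- Specular sets relative to `θ`: laminary sets that are tree sets of characteristic `2`. -/
def IsSpecular (θ : A → A) (S : Set (List A)) : Prop :=
  IsLaminary θ S ∧ IsTreeSet S 2

/-- `v` is an internal factor of `w`: `w = u v u'` with `u`, `u'` nonempty. -/
def IsInternalFactor (v w : List A) : Prop :=
  ∃ u u' : List A, u ≠ [] ∧ u' ≠ [] ∧ w = u ++ v ++ u'

/-- The complete return words to `X` in `S`: the words of `S` with a proper prefix in `X`, a
proper suffix in `X` and no internal factor in `X`. -/
def completeReturnWords (S X : Set (List A)) : Set (List A) :=
  {w | w ∈ S ∧ (∃ x ∈ X, x <+: w ∧ x ≠ w) ∧ (∃ x ∈ X, x <:+ w ∧ x ≠ w) ∧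
    ∀ x ∈ X, ¬ IsInternalFactor x w}

/-- The right return words to `x` in `S`: the words `w` such that `xw` is a complete return
word to `x`. -/
def rightReturnWords (S : Set (List A)) (x : List A) : Set (List A) :=
  {w | x ++ w ∈ completeReturnWords S {x}}

end Specular

/-! Give each `w` in `S` the multiplicity r(w) = (number of right extensions) - 1, and 0 outside
`S`. Counting edges in the extension graphs shows that the r(aw) sum to r(w) over the letters a when
w is nonempty, and that the r(a) sum to Card(A) - 2. So r spreads a mass Card(A) - 2 over left
extensions. Reading leftwards until `x` first appears stops at the words in which `x` occurs only as
a prefix; by recurrence their lengths are bounded, so together they carry the whole mass.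

Under right extension these same words are the inner nodes of a tree with root `x`, whose leaves are
the complete return words. The number of leaves is 1 plus the sum of (children - 1) over inner
nodes, that is 1 + (Card(A) - 2).

Finiteness is not known in advance, so both counts are truncated at length k and combined in
`IsTreeSet.count_invariant`. Its terms are nonnegative, which bounds the return words; recurrence
then makes all terms but the return words vanish for large k. -/

open Classical in
/-- An acyclic graph with exactly two components has two more vertices than edges. -/
theorem SimpleGraph.IsAcyclic.card_edgeSet_add_two {V : Type*} [Finite V] {G : SimpleGraph V}
    (hG : G.IsAcyclic) (hc : Nat.card G.ConnectedComponent = 2) :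
    Nat.card G.edgeSet + 2 = Nat.card V := by
  have := Fintype.ofFinite V
  obtain ⟨c, d, hcd, huniv⟩ := Nat.card_eq_two_iff.1 hc
  induction c using SimpleGraph.ConnectedComponent.ind with | _ u
  induction d using SimpleGraph.ConnectedComponent.ind with | _ v
  have hnr : ¬ G.Reachable u v := fun h => hcd (SimpleGraph.ConnectedComponent.sound h)
  have huv : u ≠ v := by rintro rfl; exact hnr (SimpleGraph.Reachable.refl _)
  -- An edge joining the two components turns the forest into a tree.
  have hle : G ≤ G ⊔ SimpleGraph.edge u v := le_sup_left
  have hvu : (G ⊔ SimpleGraph.edge u v).Reachable u v :=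
    SimpleGraph.Adj.reachable (by simp [SimpleGraph.sup_adj, SimpleGraph.edge_adj, huv])
  have hu : ∀ w, (G ⊔ SimpleGraph.edge u v).Reachable u w := by
    intro w
    have hw : G.connectedComponentMk w ∈
        ({G.connectedComponentMk u, G.connectedComponentMk v} : Set G.ConnectedComponent) := by
      rw [huniv]; trivial
    rcases hw with hw | hw
    · exact ((SimpleGraph.ConnectedComponent.exact hw).mono hle).symm
    · exact hvu.trans ((SimpleGraph.ConnectedComponent.exact hw).mono hle).symm
  have htree : (G ⊔ SimpleGraph.edge u v).IsTree :=
    ⟨{ preconnected := fun a b => (hu a).symm.trans (hu b), nonempty := ⟨u⟩ },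
      hG.sup_edge_of_not_reachable hnr⟩
  have h1 := htree.card_edgeFinset
  have h2 : (G ⊔ SimpleGraph.edge u v).edgeFinset.card = G.edgeFinset.card + 1 :=
    SimpleGraph.card_edgeFinset_sup_edge _ (fun h => hnr h.reachable) huv
  rw [Nat.card_eq_fintype_card, Nat.card_eq_fintype_card, SimpleGraph.card_edgeSet]
  omega

namespace Specular

/-! ### Extension counts and right multiplicities. -/

section Extensions

variable {A : Type*} {S : Set (List A)}

theorem IsFactorial.mem_of_append_left (hS : IsFactorial S) {u v : List A} (h : u ++ v ∈ S) :
    u ∈ S :=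
  hS.2 _ h _ (List.prefix_append u v).isInfix

theorem IsFactorial.mem_of_cons (hS : IsFactorial S) {a : A} {v : List A} (h : a :: v ∈ S) :
    v ∈ S :=
  hS.2 _ h _ (List.suffix_cons a v).isInfix

/-- The edges of the extension graph of `w` are the two-sided extensions of `w`. -/
theorem card_edgeSet_extensionGraph (hS : IsFactorial S) (w : List A) :
    Nat.card (extensionGraph S w).edgeSet = Nat.card (biExt S w) := by
  have hl : ∀ p ∈ biExt S w, p.1 ∈ leftExt S w := fun p hp =>
    hS.mem_of_append_left (u := p.1 :: w) (v := [p.2]) hp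
  have hr : ∀ p ∈ biExt S w, p.2 ∈ rightExt S w := fun p hp => hS.mem_of_cons hp
  let f : biExt S w → (extensionGraph S w).edgeSet := fun p =>
    ⟨s(.inl ⟨p.1.1, hl _ p.2⟩, .inr ⟨p.1.2, hr _ p.2⟩), p.2⟩
  refine (Nat.card_congr (Equiv.ofBijective f ⟨?_, ?_⟩)).symm
  · rintro ⟨⟨a, b⟩, h⟩ ⟨⟨a', b'⟩, h'⟩ heq
    have h1 := congrArg Subtype.val heq
    simp only [f, Sym2.eq_iff, Sum.inl.injEq, Sum.inr.injEq, Subtype.mk.injEq, reduceCtorEq,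
      false_and, or_false] at h1
    obtain ⟨rfl, rfl⟩ := h1
    rfl
  · rintro ⟨e, he⟩
    induction e using Sym2.ind with | _ s t
    rcases s with s | s <;> rcases t with t | t
    · exact he.elim
    · exact ⟨⟨(s, t), he⟩, rfl⟩
    · exact ⟨⟨(t, s), he⟩, Subtype.ext Sym2.eq_swap⟩
    · exact he.elim

theorem IsTreeSet.ncard_biExt [Finite A] {c : ℕ} (hS : IsTreeSet S c) {w : List A} (hw : w ∈ S)
    (hne : w ≠ []) :
    (biExt S w).ncard + 1 = (leftExt S w).ncard + (rightExt S w).ncard := by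
  have h := (SimpleGraph.isTree_iff_connected_and_card.1 (hS.2.1 w hw hne)).2
  rwa [card_edgeSet_extensionGraph hS.1.1, Nat.card_sum] at h

theorem IsTreeSet.ncard_biExt_nil [Finite A] (hS : IsTreeSet S 2) :
    (biExt S []).ncard + 2 = (leftExt S []).ncard + (rightExt S []).ncard := by
  obtain ⟨h1, h2⟩ := hS.2.2
  have h := h1.card_edgeSet_add_two (congrArg ENat.toNat h2)
  rwa [card_edgeSet_extensionGraph hS.1.1, Nat.card_sum] at h

/-- Two-sided extensions, counted by their left letter. -/
theorem ncard_biExt_eq_sum [Fintype A] (w : List A) :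
    (biExt S w).ncard = ∑ a : A, (rightExt S (a :: w)).ncard := by
  have e : biExt S w ≃ Σ a : A, rightExt S (a :: w) :=
    { toFun := fun p => ⟨p.1.1, p.1.2, p.2⟩
      invFun := fun p => ⟨(p.1, p.2.1), p.2.2⟩
      left_inv := fun _ => rfl
      right_inv := fun _ => rfl }
  exact (Nat.card_congr e).trans Nat.card_sigma

open Classical in
/-- The right multiplicity of a word: the number of its right extensions minus one, and `0` for
words outside `S`. -/
noncomputable def rightMult (S : Set (List A)) (w : List A) : ℤ :=
  (rightExt S w).ncard - if w ∈ S then 1 else 0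

theorem rightExt_eq_empty (hS : IsFactorial S) {w : List A} (hw : w ∉ S) : rightExt S w = ∅ :=
  Set.eq_empty_of_forall_notMem fun _ hb => hw (hS.mem_of_append_left hb)

theorem rightMult_eq_zero (hS : IsFactorial S) {w : List A} (hw : w ∉ S) : rightMult S w = 0 := by
  simp [rightMult, rightExt_eq_empty hS hw, hw]

theorem rightMult_nonneg [Finite A] (hS : IsBiextendable S) (w : List A) : 0 ≤ rightMult S w := by
  by_cases hw : w ∈ S
  · obtain ⟨p, hp⟩ := hS.2 w hw
    have : 0 < (rightExt S w).ncard := (Set.ncard_pos).2 ⟨p.2, hS.1.mem_of_cons hp⟩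
    simp only [rightMult, hw, if_true]
    omega
  · rw [rightMult_eq_zero hS.1 hw]

theorem sum_rightMult_cons_eq [Fintype A] (w : List A) :
    ∑ a : A, rightMult S (a :: w) = (biExt S w).ncard - (leftExt S w).ncard := by
  classical
  have h : (leftExt S w).ncard = ∑ a : A, if a :: w ∈ S then 1 else 0 := by
    rw [← Finset.card_filter, ← Set.ncard_coe_finset]
    congr 1
    ext a
    simp [leftExt]
  rw [ncard_biExt_eq_sum, h]
  simp [rightMult, Finset.sum_sub_distrib]

/-- In a tree, edges minus left vertices equal right vertices minus one. Outside `S` both sides are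
0. -/
theorem IsTreeSet.sum_rightMult_cons [Fintype A] {c : ℕ} (hS : IsTreeSet S c) {w : List A}
    (hne : w ≠ []) : ∑ a : A, rightMult S (a :: w) = rightMult S w := by
  by_cases hw : w ∈ S
  · have := hS.ncard_biExt hw hne
    rw [sum_rightMult_cons_eq]
    simp only [rightMult, hw, if_true]
    omega
  · rw [rightMult_eq_zero hS.1.1 hw]
    exact Finset.sum_eq_zero fun a _ =>
      rightMult_eq_zero hS.1.1 fun h => hw (hS.1.1.mem_of_cons h)

theorem IsTreeSet.sum_rightMult_singleton [Fintype A] (hS : IsTreeSet S 2) :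
    ∑ a : A, rightMult S [a] = (Fintype.card A : ℤ) - 2 := by
  have h := hS.ncard_biExt_nil
  have hr : rightExt S [] = Set.univ := Set.eq_univ_of_forall fun a => hS.1.1.1 a
  have hc : (rightExt S []).ncard = Fintype.card A := by
    rw [hr, Set.ncard_univ, Nat.card_eq_fintype_card]
  rw [sum_rightMult_cons_eq]
  omega

end Extensions

/-! ### Sums over words of a given length. -/

section Words

variable {A : Type*}

/-- The words of length `k` on a finite alphabet. -/
noncomputable def wordsOfLength (A : Type*) [Finite A] (k : ℕ) : Finset (List A) :=
  (List.finite_length_eq A k).toFinset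

@[simp]
theorem mem_wordsOfLength [Finite A] {k : ℕ} {w : List A} :
    w ∈ wordsOfLength A k ↔ w.length = k := by
  simp [wordsOfLength]

theorem sum_wordsOfLength_zero [Finite A] (f : List A → ℤ) :
    ∑ w ∈ wordsOfLength A 0, f w = f [] := by
  have : wordsOfLength A 0 = {[]} := by ext; simp
  rw [this, Finset.sum_singleton]

theorem sum_wordsOfLength_succ_cons [Fintype A] (f : List A → ℤ) (k : ℕ) :
    ∑ w ∈ wordsOfLength A (k + 1), f w = ∑ w ∈ wordsOfLength A k, ∑ a : A, f (a :: w) := by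
  classical
  have : wordsOfLength A (k + 1) =
      (wordsOfLength A k ×ˢ Finset.univ).image fun p : List A × A => p.2 :: p.1 := by
    ext w
    cases w <;> simp
  rw [this, Finset.sum_image (by rintro ⟨u, a⟩ - ⟨v, b⟩ - h; simp_all), Finset.sum_product]

theorem sum_wordsOfLength_succ_concat [Fintype A] (f : List A → ℤ) (k : ℕ) :
    ∑ w ∈ wordsOfLength A (k + 1), f w = ∑ w ∈ wordsOfLength A k, ∑ b : A, f (w ++ [b]) := by
  classical
  have : wordsOfLength A (k + 1) =
      (wordsOfLength A k ×ˢ Finset.univ).image fun p : List A × A => p.1 ++ [p.2] := by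
    ext w
    rcases List.eq_nil_or_concat w with rfl | ⟨u, b, rfl⟩ <;> simp
  rw [this, Finset.sum_image (by rintro ⟨u, a⟩ - ⟨v, b⟩ - h; simpa using h), Finset.sum_product]

/-- A finite set of words is counted by length. -/
theorem card_eq_sum_wordsOfLength [Finite A] [DecidableEq (List A)] (T : Finset (List A)) {K : ℕ}
    (hK : ∀ w ∈ T, w.length ≤ K) :
    (T.card : ℤ) =
      ∑ j ∈ Finset.range (K + 1), ∑ w ∈ wordsOfLength A j, if w ∈ T then 1 else 0 := by
  rw [Finset.card_eq_sum_card_fiberwise (f := List.length) (t := Finset.range (K + 1))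
    fun w hw => by simpa [Nat.lt_succ_iff] using hK w hw]
  push_cast
  refine Finset.sum_congr rfl fun j _ => ?_
  rw [← Finset.sum_filter, Finset.sum_const, nsmul_eq_mul, mul_one]
  congr 2
  ext w
  simp [and_comm]

end Words

/-! ### Words in which `x` occurs only as a prefix. -/

section SingleOccurrence

variable {A : Type*} {S : Set (List A)} {x : List A}

/-- The word `x` is a prefix of `w` and has no other occurrence in `w`. -/
def OccursOnlyAsPrefix (x w : List A) : Prop := x <+: w ∧ ¬ x <:+: w.tail

theorem OccursOnlyAsPrefix.ne_nil (hx : x ≠ []) {w : List A} (h : OccursOnlyAsPrefix x w) :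
    w ≠ [] := by
  rintro rfl
  exact hx (List.prefix_nil.1 h.1)

/-- Prepending a letter can create an occurrence of `x` only at the front. -/
theorem not_infix_cons_or_occursOnlyAsPrefix_cons {a : A} {w : List A} :
    (¬ x <:+: a :: w ∨ OccursOnlyAsPrefix x (a :: w)) ↔ ¬ x <:+: w := by
  simp only [OccursOnlyAsPrefix, List.tail_cons, List.infix_cons_iff]
  tauto

theorem OccursOnlyAsPrefix.infix {w : List A} (h : OccursOnlyAsPrefix x w) : x <:+: w :=
  h.1.isInfix

theorem mem_completeReturnWords_singleton {w : List A} :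
    w ∈ completeReturnWords S {x} ↔
      w ∈ S ∧ (x <+: w ∧ x ≠ w) ∧ (x <:+ w ∧ x ≠ w) ∧ ¬ IsInternalFactor x w := by
  simp only [completeReturnWords, Set.mem_ofPred_eq, Set.mem_singleton_iff, exists_eq_left,
    forall_eq]

theorem length_lt_of_mem_completeReturnWords {w : List A}
    (h : w ∈ completeReturnWords S {x}) : x.length < w.length := by
  obtain ⟨-, ⟨h1, h2⟩, -⟩ := mem_completeReturnWords_singleton.1 h
  exact lt_of_le_of_ne h1.length_le fun e => h2 (h1.eq_of_length e)

theorem not_occursOnlyAsPrefix_of_mem_completeReturnWords {w : List A}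
    (h : w ∈ completeReturnWords S {x}) : ¬ OccursOnlyAsPrefix x w := by
  rintro ⟨-, h1⟩
  obtain ⟨-, -, ⟨⟨u, rfl⟩, h2⟩, -⟩ := mem_completeReturnWords_singleton.1 h
  cases u with
  | nil => exact h2 rfl
  | cons a u => exact h1 (List.suffix_append u x).isInfix

/-- Adding a letter to a word in which `x` occurs only as a prefix either keeps this property or
yields a complete return word. -/
theorem OccursOnlyAsPrefix.concat (hx : x ≠ []) {w : List A} {b : A}
    (h : OccursOnlyAsPrefix x w) (hb : w ++ [b] ∈ S) :
    OccursOnlyAsPrefix x (w ++ [b]) ∨ w ++ [b] ∈ completeReturnWords S {x} := by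
  by_cases hs : x <:+: (w ++ [b]).tail
  · right
    obtain ⟨hp, ht⟩ := h
    obtain ⟨a, t, rfl⟩ := List.exists_cons_of_ne_nil (OccursOnlyAsPrefix.ne_nil hx ⟨hp, ht⟩)
    simp only [List.tail_cons, List.cons_append] at hs ht
    have hne : x ≠ a :: t ++ [b] := by
      intro e
      have := hp.length_le
      rw [e] at this
      simp at this
    refine mem_completeReturnWords_singleton.2
      ⟨hb, ⟨hp.trans (List.prefix_append _ _), hne⟩, ⟨?_, hne⟩, ?_⟩
    · rcases List.infix_concat_iff.1 hs with h | h
      · exact h.trans (List.suffix_cons a _)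
      · exact absurd h ht
    · rintro ⟨u, u', hu, hu', e⟩
      obtain ⟨c, u, rfl⟩ := List.exists_cons_of_ne_nil hu
      rcases List.eq_nil_or_concat u' with rfl | ⟨v, d, rfl⟩
      · exact hu' rfl
      · have e' : t ++ [b] = (u ++ x ++ v) ++ [d] := by
          simpa using (List.cons_eq_cons.1 e).2
        exact ht ⟨u, v, (List.append_inj_left' e' rfl).symm⟩
  · exact .inl ⟨h.1.trans (List.prefix_append _ _), hs⟩

/-- Converse of `OccursOnlyAsPrefix.concat`: a second occurrence of `x` inside `w` would be internal
in `w ++ [b]`. The length bound keeps the prefix `x` inside `w`. -/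
theorem OccursOnlyAsPrefix.of_concat (hx : x ≠ []) {w : List A} {b : A} (hle : x.length ≤ w.length)
    (h : OccursOnlyAsPrefix x (w ++ [b]) ∨ w ++ [b] ∈ completeReturnWords S {x}) :
    OccursOnlyAsPrefix x w := by
  have hp : x <+: w ++ [b] := h.elim (·.1) fun h => (mem_completeReturnWords_singleton.1 h).2.1.1
  refine ⟨List.prefix_of_prefix_length_le hp (List.prefix_append _ _) hle, ?_⟩
  intro ht
  obtain ⟨a, t, rfl⟩ := List.exists_cons_of_length_pos ((List.length_pos_iff.2 hx).trans_le hle)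
  obtain ⟨u, v, e⟩ := ht
  simp only [List.tail_cons] at e
  subst e
  rcases h with h | h
  · exact h.2 ⟨u, v ++ [b], by simp⟩
  · exact (mem_completeReturnWords_singleton.1 h).2.2.2
      ⟨a :: u, v ++ [b], by simp, by simp, by simp⟩

/-- In a recurrent set, the words in which `x` occurs only as a prefix are shorter than some
complete return word. -/
theorem OccursOnlyAsPrefix.exists_completeReturnWord (hrec : IsRecurrent S) (hxS : x ∈ S)
    (hx : x ≠ []) {w : List A} (hw : w ∈ S) (h : OccursOnlyAsPrefix x w) :
    ∃ y ∈ completeReturnWords S {x}, w.length < y.length := by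
  have key : ∀ (v w : List A), w ++ v ∈ S → OccursOnlyAsPrefix x w →
      ¬ OccursOnlyAsPrefix x (w ++ v) → ∃ y ∈ completeReturnWords S {x}, w.length < y.length := by
    intro v
    induction v with
    | nil => intro w _ h h'; simp [h] at h'
    | cons b v ih =>
      intro w hS h h'
      rw [List.append_cons] at hS h'
      rcases h.concat hx (hrec.2.1.mem_of_append_left hS) with h1 | h1
      · obtain ⟨y, hy, hlt⟩ := ih _ hS h1 h'
        exact ⟨y, hy, by simp at hlt; omega⟩
      · exact ⟨_, h1, by simp⟩
  -- Extend `w` to `w ++ v ++ x`, where `x` reappears; the letter at which it first does so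
  -- completes a return word.
  obtain ⟨v, -, hv⟩ := hrec.2.2 w hw x hxS
  refine key (v ++ x) w (by simpa using hv) h fun h' => h'.2 ?_
  obtain ⟨a, t, rfl⟩ := List.exists_cons_of_ne_nil (h.ne_nil hx)
  exact ⟨t ++ v, [], by simp⟩

theorem exists_suffix_occursOnlyAsPrefix (w : List A) (hw : x <:+: w) (hx : x ≠ []) :
    ∃ p, p <:+ w ∧ OccursOnlyAsPrefix x p := by
  induction w with
  | nil => exact absurd (List.infix_nil.1 hw) hx
  | cons a w ih =>
    by_cases h : x <:+: w
    · obtain ⟨p, hp, hp'⟩ := ih h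
      exact ⟨p, hp.trans (List.suffix_cons a w), hp'⟩
    · exact ⟨_, List.suffix_refl _, (List.infix_cons_iff.1 hw).resolve_right h, h⟩

/-- In a recurrent set, a word without factor `x` is shorter than some word in which `x` occurs
only as a prefix. -/
theorem exists_length_lt_of_not_infix (hrec : IsRecurrent S) (hxS : x ∈ S) (hx : x ≠ [])
    {w : List A} (hw : w ∈ S) (h : ¬ x <:+: w) :
    ∃ p ∈ S, OccursOnlyAsPrefix x p ∧ w.length < p.length := by
  obtain ⟨v, -, hv⟩ := hrec.2.2 x hxS w hw
  obtain ⟨p, hp, hpx⟩ := exists_suffix_occursOnlyAsPrefix (x ++ v ++ w)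
    ⟨[], v ++ w, by simp⟩ hx
  refine ⟨p, hrec.2.1.2 _ hv _ hp.isInfix, hpx, ?_⟩
  -- Otherwise `p` would be a suffix of `w`, and `x` a factor of `w`.
  by_contra hle
  exact h (hpx.infix.trans
    (List.suffix_of_suffix_length_le hp (List.suffix_append _ _) (by omega)).isInfix)

end SingleOccurrence

/-! ### Truncated counts and their invariant. -/

section Counting

open Classical

variable {A : Type*} [Fintype A] {S : Set (List A)} {x : List A}

/-- The total right multiplicity of the words of length `k` without factor `x`. -/
noncomputable def avoidingMult (S : Set (List A)) (x : List A) (k : ℕ) : ℤ :=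
  ∑ w ∈ wordsOfLength A k, if x <:+: w then 0 else rightMult S w

/-- The total right multiplicity of the words of length `k` in which `x` occurs only as a
prefix. -/
noncomputable def prefixMult (S : Set (List A)) (x : List A) (k : ℕ) : ℤ :=
  ∑ w ∈ wordsOfLength A k, if OccursOnlyAsPrefix x w then rightMult S w else 0

/-- The number of words of `S` of length `k` in which `x` occurs only as a prefix. -/
noncomputable def prefixCount (S : Set (List A)) (x : List A) (k : ℕ) : ℤ :=
  ∑ w ∈ wordsOfLength A k, if OccursOnlyAsPrefix x w ∧ w ∈ S then 1 else 0

/-- The number of complete return words to `x` of length `k`. -/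
noncomputable def returnCount (S : Set (List A)) (x : List A) (k : ℕ) : ℤ :=
  ∑ w ∈ wordsOfLength A k, if w ∈ completeReturnWords S {x} then 1 else 0

theorem avoidingMult_succ_add_prefixMult_succ (k : ℕ) :
    avoidingMult S x (k + 1) + prefixMult S x (k + 1) =
      ∑ w ∈ wordsOfLength A k, if x <:+: w then 0 else ∑ a : A, rightMult S (a :: w) := by
  rw [avoidingMult, prefixMult, ← Finset.sum_add_distrib, sum_wordsOfLength_succ_cons]
  refine Finset.sum_congr rfl fun w _ => ?_
  by_cases hw : x <:+: w
  · rw [if_pos hw]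
    refine Finset.sum_eq_zero fun a _ => ?_
    have h := (not_infix_cons_or_occursOnlyAsPrefix_cons (a := a)).not.2 (not_not.2 hw)
    push Not at h
    rw [if_pos h.1, if_neg h.2, add_zero]
  · rw [if_neg hw]
    refine Finset.sum_congr rfl fun a _ => ?_
    by_cases h : x <:+: a :: w
    · have h' := (not_infix_cons_or_occursOnlyAsPrefix_cons (a := a)).2 hw
      rw [if_pos h, if_pos (h'.resolve_left (not_not.2 h)), zero_add]
    · rw [if_neg h, if_neg fun h' => h h'.infix, add_zero]

theorem IsTreeSet.avoidingMult_add_prefixMult_one (hS : IsTreeSet S 2) (hx : x ≠ []) :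
    avoidingMult S x 1 + prefixMult S x 1 = (Fintype.card A : ℤ) - 2 := by
  rw [avoidingMult_succ_add_prefixMult_succ, sum_wordsOfLength_zero,
    if_neg (by simpa using hx), hS.sum_rightMult_singleton]

theorem IsTreeSet.avoidingMult_succ {c : ℕ} (hS : IsTreeSet S c) {k : ℕ} (hk : k ≠ 0) :
    avoidingMult S x (k + 1) + prefixMult S x (k + 1) = avoidingMult S x k := by
  rw [avoidingMult_succ_add_prefixMult_succ, avoidingMult]
  refine Finset.sum_congr rfl fun w hw => ?_
  rw [hS.sum_rightMult_cons]
  rintro rfl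
  simp at hw
  exact hk hw.symm

theorem prefixMult_eq_zero_of_lt {k : ℕ} (hk : k < x.length) : prefixMult S x k = 0 := by
  refine Finset.sum_eq_zero fun w hw => if_neg fun h => ?_
  have := h.1.length_le
  rw [mem_wordsOfLength] at hw
  omega

theorem IsTreeSet.avoidingMult_add_prefixMult_of_le (hS : IsTreeSet S 2) (hx : x ≠ []) {k : ℕ}
    (hk : k + 1 ≤ x.length) :
    avoidingMult S x (k + 1) + prefixMult S x (k + 1) = (Fintype.card A : ℤ) - 2 := by
  induction k with
  | zero => exact hS.avoidingMult_add_prefixMult_one hx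
  | succ k ih =>
    rw [hS.avoidingMult_succ k.succ_ne_zero, ← ih (by omega),
      prefixMult_eq_zero_of_lt (k := k + 1) (by omega), add_zero]

/-- One level of the tree rooted at `x`: the children of the nodes of length `k` are inner nodes or
leaves, and a node `w` has 1 + r(w) of them. -/
theorem prefixCount_succ_add_returnCount_succ (hx : x ≠ []) {k : ℕ}
    (hk : x.length ≤ k) :
    prefixCount S x (k + 1) + returnCount S x (k + 1) = prefixCount S x k + prefixMult S x k := by
  rw [prefixCount, returnCount, ← Finset.sum_add_distrib, sum_wordsOfLength_succ_concat,
    prefixCount, prefixMult, ← Finset.sum_add_distrib]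
  refine Finset.sum_congr rfl fun w hw => ?_
  rw [mem_wordsOfLength] at hw
  have hr : ((rightExt S w).ncard : ℤ) = ∑ b : A, if w ++ [b] ∈ S then 1 else 0 := by
    rw [← Finset.sum_filter, Finset.sum_const, nsmul_eq_mul, mul_one, ← Set.ncard_coe_finset]
    congr 2
    ext b
    simp [rightExt]
  by_cases hP : OccursOnlyAsPrefix x w
  · have : (if OccursOnlyAsPrefix x w ∧ w ∈ S then (1 : ℤ) else 0) +
        (if OccursOnlyAsPrefix x w then rightMult S w else 0) = (rightExt S w).ncard := by
      simp [hP, rightMult]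
    rw [this, hr]
    refine Finset.sum_congr rfl fun b _ => ?_
    by_cases hb : w ++ [b] ∈ S
    · have h1 := hP.concat hx hb
      have h2 := not_occursOnlyAsPrefix_of_mem_completeReturnWords (S := S) (x := x)
        (w := w ++ [b])
      by_cases h3 : w ++ [b] ∈ completeReturnWords S {x}
      · simp [h3, h2 h3, hb]
      · simp [h3, h1.resolve_right h3, hb]
    · have h3 : w ++ [b] ∉ completeReturnWords S {x} := fun h => hb h.1
      simp [hb, h3]
  · simp only [hP, false_and, if_false, add_zero]
    refine Finset.sum_eq_zero fun b _ => ?_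
    have h1 : ¬ OccursOnlyAsPrefix x (w ++ [b]) := fun h =>
      hP (OccursOnlyAsPrefix.of_concat (S := S) hx (by omega) (.inl h))
    have h2 : w ++ [b] ∉ completeReturnWords S {x} := fun h =>
      hP (OccursOnlyAsPrefix.of_concat hx (by omega) (.inr h))
    simp [h1, h2]

theorem prefixCount_length (hxS : x ∈ S) (hx : x ≠ []) : prefixCount S x x.length = 1 := by
  rw [prefixCount, Finset.sum_eq_single x]
  · refine if_pos ⟨⟨List.prefix_refl x, fun h => ?_⟩, hxS⟩
    have := h.length_le
    have := List.length_pos_iff.2 hx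
    simp at *
    omega
  · intro w hw hne
    rw [mem_wordsOfLength] at hw
    exact if_neg fun h => hne (h.1.1.eq_of_length hw.symm).symm
  · simp

theorem returnCount_eq_zero_of_le {k : ℕ} (hk : k ≤ x.length) : returnCount S x k = 0 := by
  refine Finset.sum_eq_zero fun w hw => if_neg fun h => ?_
  have := length_lt_of_mem_completeReturnWords h
  rw [mem_wordsOfLength] at hw
  omega

/-- Passing from `k` to `k + 1`, the mass `prefixMult S x k` leaves the last bracket and becomes the
growth of the first two terms. At `k = x.length` the three terms are 1, 0 and Card(A) - 2. -/
theorem IsTreeSet.count_invariant (hS : IsTreeSet S 2) (hxS : x ∈ S) (hx : x ≠ []) {k : ℕ}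
    (hk : x.length ≤ k) :
    prefixCount S x k + ∑ j ∈ Finset.range (k + 1), returnCount S x j +
      (avoidingMult S x k + prefixMult S x k) = (Fintype.card A : ℤ) - 1 := by
  have hpos := List.length_pos_iff.2 hx
  induction k, hk using Nat.le_induction with
  | base =>
    obtain ⟨m, hm⟩ := Nat.exists_eq_add_of_lt hpos
    rw [prefixCount_length hxS hx, Finset.sum_eq_zero fun j hj =>
      returnCount_eq_zero_of_le (Nat.lt_succ_iff.1 (Finset.mem_range.1 hj)),
      show x.length = m + 1 by omega, hS.avoidingMult_add_prefixMult_of_le hx (by omega)]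
    ring
  | succ k hk ih =>
    have h1 := prefixCount_succ_add_returnCount_succ (S := S) hx hk
    have h2 := hS.avoidingMult_succ (x := x) (k := k) (by omega)
    rw [Finset.sum_range_succ]
    linarith

theorem IsTreeSet.sum_returnCount_le (hS : IsTreeSet S 2) (hxS : x ∈ S) (hx : x ≠ []) (k : ℕ) :
    ∑ j ∈ Finset.range (k + 1), returnCount S x j ≤ (Fintype.card A : ℤ) - 1 := by
  -- The invariant needs a length of at least `x.length`, hence the maximum.
  have hmono : ∑ j ∈ Finset.range (k + 1), returnCount S x j ≤
      ∑ j ∈ Finset.range (max k x.length + 1), returnCount S x j :=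
    Finset.sum_le_sum_of_subset_of_nonneg (Finset.range_mono (by omega)) fun j _ _ =>
      Finset.sum_nonneg fun w _ => by split_ifs <;> norm_num
  have h := hS.count_invariant hxS hx (le_max_right k x.length)
  have h1 : 0 ≤ prefixCount S x (max k x.length) :=
    Finset.sum_nonneg fun w _ => by split_ifs <;> norm_num
  have h2 : 0 ≤ avoidingMult S x (max k x.length) := Finset.sum_nonneg fun w _ => by
    split_ifs
    exacts [le_rfl, rightMult_nonneg hS.1 w]
  have h3 : 0 ≤ prefixMult S x (max k x.length) := Finset.sum_nonneg fun w _ => by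
    split_ifs
    exacts [rightMult_nonneg hS.1 w, le_rfl]
  linarith

theorem IsTreeSet.finite_completeReturnWords (hS : IsTreeSet S 2) (hxS : x ∈ S) (hx : x ≠ []) :
    (completeReturnWords S {x}).Finite := by
  by_contra hinf
  -- Card(A) return words are already one more than the bound allows.
  obtain ⟨T, hT, hcard⟩ := Set.Infinite.exists_subset_card_eq hinf (Fintype.card A)
  have h1 := card_eq_sum_wordsOfLength T (K := T.sup List.length)
    fun w hw => Finset.le_sup (f := List.length) hw
  have h2 := hS.sum_returnCount_le hxS hx (T.sup List.length)
  have h3 : (T.card : ℤ) ≤ ∑ j ∈ Finset.range (T.sup List.length + 1), returnCount S x j := by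
    rw [h1]
    refine Finset.sum_le_sum fun j _ => Finset.sum_le_sum fun w _ => ?_
    by_cases hw : w ∈ T
    · rw [if_pos hw, if_pos (hT hw)]
    · rw [if_neg hw]
      split_ifs <;> norm_num
  omega

theorem IsTreeSet.ncard_completeReturnWords (hS : IsTreeSet S 2) (hrec : IsRecurrent S)
    (hxS : x ∈ S) (hx : x ≠ []) :
    (completeReturnWords S {x}).ncard = Fintype.card A - 1 := by
  have hfin := hS.finite_completeReturnWords hxS hx
  set T := hfin.toFinset with hT
  have hmem : ∀ w, w ∈ T ↔ w ∈ completeReturnWords S {x} := fun w => by simp [hT]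
  have hle : ∀ w ∈ T, w.length ≤ T.sup List.length := fun w hw =>
    Finset.le_sup (f := List.length) hw
  -- At length `K` no word of `S` avoids `x` or has it only as a prefix: each such word is strictly
  -- shorter than some return word.
  set K := max (T.sup List.length) x.length
  have hP : ∀ w ∈ S, OccursOnlyAsPrefix x w → w.length < K := fun w hw h => by
    obtain ⟨y, hy, hlt⟩ := h.exists_completeReturnWord hrec hxS hx hw
    exact hlt.trans_le ((hle y ((hmem y).2 hy)).trans (le_max_left _ _))
  have hN : ∀ w ∈ S, ¬ x <:+: w → w.length < K := fun w hw h => by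
    obtain ⟨p, hp, hpx, hlt⟩ := exists_length_lt_of_not_infix hrec hxS hx hw h
    exact hlt.trans (hP p hp hpx)
  have h1 : prefixCount S x K = 0 := Finset.sum_eq_zero fun w hw => if_neg fun h => by
    have := hP w h.2 h.1
    rw [mem_wordsOfLength] at hw
    omega
  have h2 : avoidingMult S x K = 0 := Finset.sum_eq_zero fun w hw => by
    split_ifs with h
    · rfl
    · refine rightMult_eq_zero hS.1.1 fun hwS => ?_
      have := hN w hwS h
      rw [mem_wordsOfLength] at hw
      omega
  have h3 : prefixMult S x K = 0 := Finset.sum_eq_zero fun w hw => by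
    split_ifs with h
    · refine rightMult_eq_zero hS.1.1 fun hwS => ?_
      have := hP w hwS h
      rw [mem_wordsOfLength] at hw
      omega
    · rfl
  have h4 := hS.count_invariant hxS hx (le_max_right (T.sup List.length) x.length)
  have h5 := card_eq_sum_wordsOfLength T (K := K) fun w hw => (hle w hw).trans (le_max_left _ _)
  simp only [hmem] at h5
  change (T.card : ℤ) = ∑ j ∈ Finset.range (K + 1), returnCount S x j at h5
  change prefixCount S x K + ∑ j ∈ Finset.range (K + 1), returnCount S x j +
    (avoidingMult S x K + prefixMult S x K) = (Fintype.card A : ℤ) - 1 at h4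
  rw [Set.ncard_eq_toFinset_card _ hfin, ← hT]
  omega

end Counting

/-! ### From complete to right return words. -/

theorem image_append_rightReturnWords {A : Type*} (S : Set (List A)) (x : List A) :
    (x ++ ·) '' rightReturnWords S x = completeReturnWords S {x} := by
  ext w
  constructor
  · rintro ⟨v, hv, rfl⟩
    exact hv
  · intro hw
    obtain ⟨v, rfl⟩ := (mem_completeReturnWords_singleton.1 hw).2.1.1
    exact ⟨v, hw, rfl⟩

end Specular

theorem mainTheorem12 {A : Type*} [Fintype A] (θ : A → A) (hθ : Function.Involutive θ)
    (S : Set (List A)) (hS : Specular.IsSpecular θ S) (hrec : Specular.IsRecurrent S)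
    (x : List A) (hxS : x ∈ S) (hx : x ≠ []) :
    (Specular.rightReturnWords S x).Finite ∧
      (Specular.rightReturnWords S x).ncard = Fintype.card A - 1 := by
  have hinj : Function.Injective (x ++ · : List A → List A) := List.append_right_injective x
  have himg := Specular.image_append_rightReturnWords S x
  refine ⟨?_, ?_⟩
  · refine Set.Finite.of_finite_image ?_ hinj.injOn
    rw [himg]
    exact hS.2.finite_completeReturnWords hxS hx
  · rw [← Set.ncard_image_of_injective _ hinj, himg, hS.2.ncard_completeReturnWords hrec hxS hx]
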